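/- Let $M$ be a smooth manifold, and let $TM\oplus T^*M$ carry the pairing $\langle X+\xi,Y+\eta\rangle=\eta(X)+\xi(Y)$ and the Courant bracket $$[X+\xi,Y+\eta]_C=[X,Y]+\mathcal L_X\eta-\mathcal L_Y\xi-\tfrac12 d(\iota_X\eta-\iota_Y\xi).$$ A generalized almost para-complex structure is a smooth endomorphism $\mathfrak P$ of $TM\oplus T^*M$ such that $\mathfrak P^2=\mathrm{Id}$, $\langle\mathfrak Pv,\mathfrak Pw\rangle=\langle v,w\rangle$ for all $v,w$, and the $\pm1$-eigenbundles of $\mathfrak P$ have the same rank. Let $\mathfrak P=\begin{bmatrix}H&\alpha\\ \beta&K\end{bmatrix}$ be such a structure, with $H:TM\to TM$, $\alpha:T^*M\to TM$, $\beta:TM\to T^*M$, $K:T^*M\to T^*M$, and suppose that $\alpha$ is invertible. For a vector field $X$ put $$X^{\pm}=X\pm\alpha^{-1}X-\alpha^{-1}HX,$$ which is a section of the $\pm1$-eigenbundle, and let $\nabla^+$ be the affine connection on $M$ given by $$\nabla^+_XY=\pi\Big(\tfrac12(\mathrm{Id}+\mathfrak P)\,[X^-,Y^+]_C\Big),$$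 where $\pi:TM\oplus T^*M\to TM$ is the projection; denote also by $\nabla^+$ the dual connection on $T^*M$. Let $$[X+\xi,Y+\eta]_{\nabla^+}=[X,Y]+\nabla^+_X\eta-\nabla^+_Y\xi .$$ If $\nabla^+\alpha=0$, $\nabla^+H=0$ and the $2$-form $\alpha^{-1}H$, $(X,Y)\mapsto(\alpha^{-1}HX)(Y)$, satisfies $d(\alpha^{-1}H)=0$, then $\mathfrak P$ is $[\cdot,\cdot]_{\nabla^+}$-integrable, i.e. $$[\mathfrak Pv,\mathfrak Pw]_{\nabla^+}-\mathfrak P[\mathfrak Pv,w]_{\nabla^+}-\mathfrak P[v,\mathfrak Pw]_{\nabla^+}+\mathfrak P^2[v,w]_{\nabla^+}=0$$ for all smooth sections $v,w$ of $TM\oplus T^*M$. -/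

import Mathlib

open Bundle
open scoped Manifold ContDiff

noncomputable section

namespace GenGeom

variable {E : Type*} [NormedAddCommGroup E] [NormedSpace ℝ E]
  {H : Type*} [TopologicalSpace H] (I : ModelWithCorners ℝ E H)
  {M : Type*} [TopologicalSpace M] [ChartedSpace H M]

/-! ### Vector fields, one-forms and the generalized tangent bundle -/

/-- The cotangent space `T*_x M`. -/
abbrev Cotangent (x : M) : Type _ := TangentSpace I x →L[ℝ] ℝ

/-- The fibre `T_x M ⊕ T*_x M` of the generalized tangent bundle. -/
abbrev GT (x : M) : Type _ := TangentSpace I x × Cotangent I x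

/-- Smoothness of a vector field. -/
def IsSmoothVF [IsManifold I ∞ M] (X : Π x : M, TangentSpace I x) : Prop :=
  ContMDiff I (I.prod 𝓘(ℝ, E)) ∞ (fun x ↦ TotalSpace.mk' E x (X x))

/-- Smoothness of a one-form, as a section of the cotangent bundle. -/
def IsSmoothForm [IsManifold I ∞ M] (η : Π x : M, Cotangent I x) : Prop :=
  ContMDiff I (I.prod 𝓘(ℝ, E →L[ℝ] ℝ)) ∞
    (fun x ↦ TotalSpace.mk' (E →L[ℝ] ℝ) (E := fun x : M ↦ Cotangent I x) x (η x))

/-- Smoothness of a section `X + ξ` of `TM ⊕ T*M`. -/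
def IsSmoothSection [IsManifold I ∞ M] (v : Π x : M, GT I x) : Prop :=
  IsSmoothVF I (fun x ↦ (v x).1) ∧ IsSmoothForm I (fun x ↦ (v x).2)

variable {I}

/-- The natural pairing `⟨X + ξ, Y + η⟩ = η(X) + ξ(Y)`. -/
def pairing {x : M} (u v : GT I x) : ℝ := v.2 u.1 + u.2 v.1

/-- The derivative `X(f)` of a function along a vector field. -/
def dirDeriv (X : Π x : M, TangentSpace I x) (f : M → ℝ) (x : M) : ℝ :=
  mvfderiv I f x (X x)

/-- The function `ι_X η = η(X)`. -/
def contr (η : Π x : M, Cotangent I x) (X : Π x : M, TangentSpace I x) (x : M) : ℝ :=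
  η x (X x)

theorem contr_mdifferentiableAt [IsManifold I ∞ M] {η : Π x : M, Cotangent I x} {Z : Π x : M, TangentSpace I x}
    {x : M}
    (hη : MDifferentiableAt I (I.prod 𝓘(ℝ, E →L[ℝ] ℝ))
      (fun y ↦ TotalSpace.mk' (E →L[ℝ] ℝ) (E := fun x : M ↦ Cotangent I x) y (η y)) x)
    (hZ : MDifferentiableAt I (I.prod 𝓘(ℝ, E)) (fun y ↦ TotalSpace.mk' E y (Z y)) x) :
    MDifferentiableAt I 𝓘(ℝ, ℝ) (contr η Z) x := by
  have h : MDifferentiableAt I (I.prod 𝓘(ℝ, ℝ))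
      (fun m ↦ TotalSpace.mk' ℝ (E := Bundle.Trivial M ℝ) m (η m (Z m))) x :=
    MDifferentiableAt.clm_bundle_apply (F₁ := E) (F₂ := ℝ) (E₂ := Bundle.Trivial M ℝ) hη hZ
  simp only [mdifferentiableAt_totalSpace] at h
  exact h.2

section Differential

variable [FiniteDimensional ℝ E] [IsManifold I ∞ M]

open Classical in
/-- The one-form defined by a function-linear operation `Φ` on vector fields: at each point `x`
where `Φ` is tensorial, it is the covector `ω_x` with `ω_x (Z x) = Φ Z x` for every vector field `Z`
that is differentiable at `x`. (Where `Φ` is not tensorial the value is `0`.) -/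
def formOf (Φ : (Π x : M, TangentSpace I x) → M → ℝ) (x : M) : Cotangent I x :=
  if h : TensorialAt I E (fun Z ↦ Φ Z x) x then TensorialAt.mkHom (fun Z ↦ Φ Z x) x h else 0

theorem formOf_apply {Φ : (Π x : M, TangentSpace I x) → M → ℝ} {x : M}
    (h : TensorialAt I E (fun Z ↦ Φ Z x) x) {Z : Π x : M, TangentSpace I x}
    (hZ : MDifferentiableAt I (I.prod 𝓘(ℝ, E)) (fun y ↦ TotalSpace.mk' E y (Z y)) x) :
    formOf Φ x (Z x) = Φ Z x := by
  rw [formOf, dif_pos h]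
  exact TensorialAt.mkHom_apply h hZ

/-- The Lie derivative of a one-form: `(𝓛_X η)(Z) = X(η(Z)) - η([X, Z])`. -/
def lieDerivForm (X : Π x : M, TangentSpace I x) (η : Π x : M, Cotangent I x) :
    Π x : M, Cotangent I x :=
  formOf fun Z x ↦ dirDeriv X (contr η Z) x - η x (VectorField.mlieBracket I X Z x)

/-- The Lie derivative of a one-form is given by the usual formula on vector fields. -/
theorem lieDerivForm_apply {X : Π x : M, TangentSpace I x} {η : Π x : M, Cotangent I x} {x : M}
    (hη : MDifferentiableAt I (I.prod 𝓘(ℝ, E →L[ℝ] ℝ))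
      (fun y ↦ TotalSpace.mk' (E →L[ℝ] ℝ) (E := fun x : M ↦ Cotangent I x) y (η y)) x)
    {Z : Π x : M, TangentSpace I x}
    (hZ : MDifferentiableAt I (I.prod 𝓘(ℝ, E)) (fun y ↦ TotalSpace.mk' E y (Z y)) x) :
    lieDerivForm X η x (Z x) =
      dirDeriv X (contr η Z) x - η x (VectorField.mlieBracket I X Z x) := by
  refine formOf_apply ⟨?_, ?_⟩ hZ
  · intro f Z hf hZ
    have e : contr η (f • Z) = f * contr η Z := by
      funext y; simp [contr]
    rw [e, VectorField.mlieBracket_smul_right hf hZ, dirDeriv, dirDeriv,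
      mvfderiv_mul hf (contr_mdifferentiableAt hη hZ)]
    simp [contr]
    ring
  · intro Z Z' hZ hZ'
    have e : contr η (Z + Z') = contr η Z + contr η Z' := by
      funext y; simp [contr]
    rw [e, VectorField.mlieBracket_add_right hZ hZ', dirDeriv, dirDeriv, dirDeriv,
      mvfderiv_add (contr_mdifferentiableAt hη hZ) (contr_mdifferentiableAt hη hZ')]
    simp only [add_apply, map_add]
    ring

/-- The Courant bracket
`[X + ξ, Y + η]_C = [X, Y] + 𝓛_X η - 𝓛_Y ξ - ½ d(ι_X η - ι_Y ξ)`. -/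
def courant (v w : Π x : M, GT I x) (x : M) : GT I x :=
  (VectorField.mlieBracket I (fun y ↦ (v y).1) (fun y ↦ (w y).1) x,
    lieDerivForm (fun y ↦ (v y).1) (fun y ↦ (w y).2) x
      - lieDerivForm (fun y ↦ (w y).1) (fun y ↦ (v y).2) x
      - (1 / 2 : ℝ) • mvfderiv I
          (fun y ↦ (w y).2 (v y).1 - (v y).2 (w y).1) x)

/-- The connection on one-forms dual to `∇`: `(∇_X η)(Z) = X(η(Z)) - η(∇_X Z)`. -/
def dualConn (nabla : (Π x : M, TangentSpace I x) → (Π x : M, TangentSpace I x) →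
      (Π x : M, TangentSpace I x))
    (X : Π x : M, TangentSpace I x) (η : Π x : M, Cotangent I x) : Π x : M, Cotangent I x :=
  formOf fun Z x ↦ dirDeriv X (contr η Z) x - η x (nabla X Z x)

/-- For an operation that is additive and satisfies the Leibniz rule in its second argument (as a
connection is), the dual connection is given by the usual formula on vector fields. -/
theorem dualConn_apply {nabla : (Π x : M, TangentSpace I x) → (Π x : M, TangentSpace I x) →
      (Π x : M, TangentSpace I x)} {X : Π x : M, TangentSpace I x} {x : M}
    (hadd : ∀ {Z Z' : Π x : M, TangentSpace I x},
      MDifferentiableAt I (I.prod 𝓘(ℝ, E)) (fun y ↦ TotalSpace.mk' E y (Z y)) x →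
      MDifferentiableAt I (I.prod 𝓘(ℝ, E)) (fun y ↦ TotalSpace.mk' E y (Z' y)) x →
      nabla X (Z + Z') x = nabla X Z x + nabla X Z' x)
    (hleib : ∀ {f : M → ℝ} {Z : Π x : M, TangentSpace I x}, MDifferentiableAt I 𝓘(ℝ, ℝ) f x →
      MDifferentiableAt I (I.prod 𝓘(ℝ, E)) (fun y ↦ TotalSpace.mk' E y (Z y)) x →
      nabla X (f • Z) x = f x • nabla X Z x + dirDeriv X f x • Z x)
    {η : Π x : M, Cotangent I x}
    (hη : MDifferentiableAt I (I.prod 𝓘(ℝ, E →L[ℝ] ℝ))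
      (fun y ↦ TotalSpace.mk' (E →L[ℝ] ℝ) (E := fun x : M ↦ Cotangent I x) y (η y)) x)
    {Z : Π x : M, TangentSpace I x}
    (hZ : MDifferentiableAt I (I.prod 𝓘(ℝ, E)) (fun y ↦ TotalSpace.mk' E y (Z y)) x) :
    dualConn nabla X η x (Z x) = dirDeriv X (contr η Z) x - η x (nabla X Z x) := by
  refine formOf_apply ⟨?_, ?_⟩ hZ
  · intro f Z hf hZ
    have e : contr η (f • Z) = f * contr η Z := by
      funext y; simp [contr]
    rw [e, hleib hf hZ, dirDeriv, dirDeriv, dirDeriv,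
      mvfderiv_mul hf (contr_mdifferentiableAt hη hZ)]
    simp [contr]
    ring
  · intro Z Z' hZ hZ'
    have e : contr η (Z + Z') = contr η Z + contr η Z' := by
      funext y; simp [contr]
    rw [e, hadd hZ hZ', dirDeriv, dirDeriv, dirDeriv,
      mvfderiv_add (contr_mdifferentiableAt hη hZ) (contr_mdifferentiableAt hη hZ')]
    simp only [add_apply, map_add]
    ring

/-- The bracket `[X + ξ, Y + η]_∇ = [X, Y] + ∇_X η - ∇_Y ξ` on sections of `TM ⊕ T*M` induced by a
connection `∇` on `TM`. -/
def connBracket (nabla : (Π x : M, TangentSpace I x) → (Π x : M, TangentSpace I x) →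
      (Π x : M, TangentSpace I x)) (v w : Π x : M, GT I x) (x : M) : GT I x :=
  (VectorField.mlieBracket I (fun y ↦ (v y).1) (fun y ↦ (w y).1) x,
    dualConn nabla (fun y ↦ (v y).1) (fun y ↦ (w y).2) x
      - dualConn nabla (fun y ↦ (w y).1) (fun y ↦ (v y).2) x)

end Differential

/-- The exterior derivative of a two-form `b`, evaluated on three vector fields:
`db(X, Y, Z) = X b(Y, Z) - Y b(X, Z) + Z b(X, Y) - b([X, Y], Z) + b([X, Z], Y) - b([Y, Z], X)`. -/
def extDerivTwo (b : Π x : M, TangentSpace I x →L[ℝ] Cotangent I x)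
    (X Y Z : Π x : M, TangentSpace I x) (x : M) : ℝ :=
  dirDeriv X (fun y ↦ b y (Y y) (Z y)) x - dirDeriv Y (fun y ↦ b y (X y) (Z y)) x
    + dirDeriv Z (fun y ↦ b y (X y) (Y y)) x
    - b x (VectorField.mlieBracket I X Y x) (Z x) + b x (VectorField.mlieBracket I X Z x) (Y x)
    - b x (VectorField.mlieBracket I Y Z x) (X x)

/-! ### Endomorphisms of the generalized tangent bundle -/

/-- The block `TM → TM` of an endomorphism `P = [[H, α], [β, K]]`. -/
def blockH (P : Π x : M, GT I x →L[ℝ] GT I x) (x : M) : TangentSpace I x →L[ℝ] TangentSpace I x :=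
  ContinuousLinearMap.fst ℝ _ _ ∘L P x ∘L ContinuousLinearMap.inl ℝ _ _

/-- The block `T*M → TM`. -/
def blockAlpha (P : Π x : M, GT I x →L[ℝ] GT I x) (x : M) : Cotangent I x →L[ℝ] TangentSpace I x :=
  ContinuousLinearMap.fst ℝ _ _ ∘L P x ∘L ContinuousLinearMap.inr ℝ _ _

/-- The block `TM → T*M`. -/
def blockBeta (P : Π x : M, GT I x →L[ℝ] GT I x) (x : M) : TangentSpace I x →L[ℝ] Cotangent I x :=
  ContinuousLinearMap.snd ℝ _ _ ∘L P x ∘L ContinuousLinearMap.inl ℝ _ _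

/-- The block `T*M → T*M`. -/
def blockK (P : Π x : M, GT I x →L[ℝ] GT I x) (x : M) : Cotangent I x →L[ℝ] Cotangent I x :=
  ContinuousLinearMap.snd ℝ _ _ ∘L P x ∘L ContinuousLinearMap.inr ℝ _ _

/-- Smoothness of a bundle endomorphism of `TM ⊕ T*M`: its four blocks are smooth sections of the
corresponding bundles of homomorphisms. -/
structure IsSmoothEnd [IsManifold I ∞ M] (P : Π x : M, GT I x →L[ℝ] GT I x) : Prop where
  smooth_H : ContMDiff I (I.prod 𝓘(ℝ, E →L[ℝ] E)) ∞
    (fun x ↦ TotalSpace.mk' (E →L[ℝ] E)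
      (E := fun x : M ↦ TangentSpace I x →L[ℝ] TangentSpace I x) x (blockH P x))
  smooth_alpha : ContMDiff I (I.prod 𝓘(ℝ, (E →L[ℝ] ℝ) →L[ℝ] E)) ∞
    (fun x ↦ TotalSpace.mk' ((E →L[ℝ] ℝ) →L[ℝ] E)
      (E := fun x : M ↦ Cotangent I x →L[ℝ] TangentSpace I x) x (blockAlpha P x))
  smooth_beta : ContMDiff I (I.prod 𝓘(ℝ, E →L[ℝ] (E →L[ℝ] ℝ))) ∞
    (fun x ↦ TotalSpace.mk' (E →L[ℝ] (E →L[ℝ] ℝ))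
      (E := fun x : M ↦ TangentSpace I x →L[ℝ] Cotangent I x) x (blockBeta P x))
  smooth_K : ContMDiff I (I.prod 𝓘(ℝ, (E →L[ℝ] ℝ) →L[ℝ] (E →L[ℝ] ℝ))) ∞
    (fun x ↦ TotalSpace.mk' ((E →L[ℝ] ℝ) →L[ℝ] (E →L[ℝ] ℝ))
      (E := fun x : M ↦ Cotangent I x →L[ℝ] Cotangent I x) x (blockK P x))

/-- A generalized almost para-complex structure: a smooth endomorphism `P` of `TM ⊕ T*M` with
`P² = Id`, orthogonal for the natural pairing, whose eigenbundles for `1` and `-1` have the same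
rank. -/
structure IsGenAlmostParaComplex [IsManifold I ∞ M] (P : Π x : M, GT I x →L[ℝ] GT I x) :
    Prop where
  smooth : IsSmoothEnd P
  sq_eq_id : ∀ (x : M) (v : GT I x), P x (P x v) = v
  orthogonal : ∀ (x : M) (v w : GT I x), pairing (P x v) (P x w) = pairing v w
  rank_eq : ∀ x : M,
    Module.finrank ℝ (Module.End.eigenspace (P x : GT I x →ₗ[ℝ] GT I x) 1) =
      Module.finrank ℝ (Module.End.eigenspace (P x : GT I x →ₗ[ℝ] GT I x) (-1))

/-- `α⁻¹ : TM → T*M` (meaningful when `α` is invertible). -/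
def alphaInv (P : Π x : M, GT I x →L[ℝ] GT I x) (x : M) : TangentSpace I x →L[ℝ] Cotangent I x :=
  (blockAlpha P x).inverse

/-- The two-form `α⁻¹ H`, `(X, Y) ↦ (α⁻¹ H X)(Y)`. -/
def alphaInvH (P : Π x : M, GT I x →L[ℝ] GT I x) (x : M) : TangentSpace I x →L[ℝ] Cotangent I x :=
  alphaInv P x ∘L blockH P x

/-- The lift `X⁺ = X + α⁻¹ X - α⁻¹ H X` of a vector field to `V⁺`. -/
def liftPlus (P : Π x : M, GT I x →L[ℝ] GT I x) (X : Π x : M, TangentSpace I x) (x : M) :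
    GT I x :=
  (X x, alphaInv P x (X x) - alphaInvH P x (X x))

/-- The lift `X⁻ = X - α⁻¹ X - α⁻¹ H X` of a vector field to `V⁻`. -/
def liftMinus (P : Π x : M, GT I x →L[ℝ] GT I x) (X : Π x : M, TangentSpace I x) (x : M) :
    GT I x :=
  (X x, -alphaInv P x (X x) - alphaInvH P x (X x))

/-- The projection `½ (Id + P)` onto the eigenbundle `V⁺`. -/
def projPlus (P : Π x : M, GT I x →L[ℝ] GT I x) (x : M) (v : GT I x) : GT I x :=
  (1 / 2 : ℝ) • (v + P x v)

section Connection

variable [FiniteDimensional ℝ E] [IsManifold I ∞ M]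

/-- The connection on `TM` induced by `P`: `∇⁺_X Y = π(([X⁻, Y⁺]_C)₊)`. -/
def nablaPlus (P : Π x : M, GT I x →L[ℝ] GT I x) (X Y : Π x : M, TangentSpace I x) (x : M) :
    TangentSpace I x :=
  (projPlus P x (courant (liftMinus P X) (liftPlus P Y) x)).1

/-- `∇H = 0` for a field `H` of endomorphisms of `TM`: `(∇_X H)(Y) = ∇_X (H Y) - H (∇_X Y) = 0` for
all smooth vector fields `X`, `Y`. -/
def IsParallelTT (nabla : (Π x : M, TangentSpace I x) → (Π x : M, TangentSpace I x) →
      (Π x : M, TangentSpace I x))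
    (A : Π x : M, TangentSpace I x →L[ℝ] TangentSpace I x) : Prop :=
  ∀ X Y : Π x : M, TangentSpace I x, IsSmoothVF I X → IsSmoothVF I Y →
    ∀ x, nabla X (fun y ↦ A y (Y y)) x - A x (nabla X Y x) = 0

/-- `∇α = 0` for a bundle map `α : T*M → TM`: `(∇_X α)(η) = ∇_X (α η) - α (∇_X η) = 0` for all
smooth vector fields `X` and smooth one-forms `η`. -/
def IsParallelCT (nabla : (Π x : M, TangentSpace I x) → (Π x : M, TangentSpace I x) →
      (Π x : M, TangentSpace I x))
    (A : Π x : M, Cotangent I x →L[ℝ] TangentSpace I x) : Prop :=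
  ∀ (X : Π x : M, TangentSpace I x) (η : Π x : M, Cotangent I x),
    IsSmoothVF I X → IsSmoothForm I η →
    ∀ x, nabla X (fun y ↦ A y (η y)) x - A x (dualConn nabla X η x) = 0

end Connection

/-- A two-form is closed: its exterior derivative vanishes on all smooth vector fields. -/
def IsClosedTwo [IsManifold I ∞ M] (b : Π x : M, TangentSpace I x →L[ℝ] Cotangent I x) : Prop :=
  ∀ X Y Z : Π x : M, TangentSpace I x, IsSmoothVF I X → IsSmoothVF I Y → IsSmoothVF I Z →
    ∀ x, extDerivTwo b X Y Z x = 0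

/-- The Nijenhuis operator of an endomorphism `P` with respect to a bracket on sections:
`N_P(v, w) = [Pv, Pw] - P[Pv, w] - P[v, Pw] + P²[v, w]`. -/
def nijenhuis
    (br : (Π x : M, GT I x) → (Π x : M, GT I x) → (Π x : M, GT I x))
    (P : Π x : M, GT I x →L[ℝ] GT I x) (v w : Π x : M, GT I x) (x : M) : GT I x :=
  br (fun y ↦ P y (v y)) (fun y ↦ P y (w y)) x
    - P x (br (fun y ↦ P y (v y)) w x)
    - P x (br v (fun y ↦ P y (w y)) x)
    + P x (P x (br v w x))

/-- `P` is integrable with respect to a bracket on sections: its Nijenhuis operator vanishes on all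
smooth sections. -/
def IsIntegrable [IsManifold I ∞ M]
    (br : (Π x : M, GT I x) → (Π x : M, GT I x) → (Π x : M, GT I x))
    (P : Π x : M, GT I x →L[ℝ] GT I x) : Prop :=
  ∀ v w : Π x : M, GT I x, IsSmoothSection I v → IsSmoothSection I w →
    ∀ x, nijenhuis br P v w x = 0

end GenGeom

end

open Bundle
open scoped Manifold ContDiff

noncomputable section

namespace GenGeom

/-! Two facts about ∇ = ∇⁺ suffice: it is torsion-free, and P is parallel for the connection it
induces on TM ⊕ T*M. By the first, [v,w]_∇ = ∇_{πv} w - ∇_{πw} v; by the second, P passes through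
every ∇, and since P² = 1 the Nijenhuis expression cancels term by term.

Torsion (`nablaPlus_torsion_eq_zero`): antisymmetrize the form part of [X⁻, Y⁺]_C in X and Y. The
α⁻¹ terms are symmetric and drop out; the b = α⁻¹H terms give -2 db(X,Y,·) - 2 b([X,Y],·). If db =
0, applying α leaves -2H[X,Y], which cancels the H[X,Y] terms of ½(Id + P).

Parallelism (`genConn_nablaPlus_apply`): P² = 1 gives αβ = 1 - H² and αK = -Hα, so β and K are
determined by H and the invertible α, and are parallel when these are. -/

/-! ### Smooth bundle preliminaries. -/

open ContinuousLinearMap in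
/-- The pointwise inverse of a smooth field of invertible bundle maps is smooth. -/
theorem contMDiff_inverse_hom {𝕜 B F₁ F₂ : Type*} [NontriviallyNormedField 𝕜]
    {n : WithTop ℕ∞} {E₁ E₂ : B → Type*}
    [∀ x, AddCommGroup (E₁ x)] [∀ x, Module 𝕜 (E₁ x)] [NormedAddCommGroup F₁] [NormedSpace 𝕜 F₁]
    [CompleteSpace F₁]
    [TopologicalSpace (TotalSpace F₁ E₁)] [∀ x, TopologicalSpace (E₁ x)]
    [∀ x, AddCommGroup (E₂ x)] [∀ x, Module 𝕜 (E₂ x)] [NormedAddCommGroup F₂] [NormedSpace 𝕜 F₂]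
    [TopologicalSpace (TotalSpace F₂ E₂)] [∀ x, TopologicalSpace (E₂ x)]
    {EB : Type*} [NormedAddCommGroup EB] [NormedSpace 𝕜 EB] {HB : Type*} [TopologicalSpace HB]
    {IB : ModelWithCorners 𝕜 EB HB} [TopologicalSpace B] [ChartedSpace HB B]
    [FiberBundle F₁ E₁] [VectorBundle 𝕜 F₁ E₁] [FiberBundle F₂ E₂] [VectorBundle 𝕜 F₂ E₂]
    [∀ x, IsTopologicalAddGroup (E₁ x)] [∀ x, ContinuousSMul 𝕜 (E₁ x)]
    [∀ x, IsTopologicalAddGroup (E₂ x)] [∀ x, ContinuousSMul 𝕜 (E₂ x)]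
    {φ : Π x, E₁ x →L[𝕜] E₂ x} (hφ : ∀ x, (φ x).IsInvertible)
    (h : ContMDiff IB (IB.prod 𝓘(𝕜, F₁ →L[𝕜] F₂)) n
      (fun x ↦ TotalSpace.mk' (F₁ →L[𝕜] F₂) (E := fun x ↦ E₁ x →L[𝕜] E₂ x) x (φ x))) :
    ContMDiff IB (IB.prod 𝓘(𝕜, F₂ →L[𝕜] F₁)) n
      (fun x ↦ TotalSpace.mk' (F₂ →L[𝕜] F₁) (E := fun x ↦ E₂ x →L[𝕜] E₁ x) x
        (φ x).inverse) := by
  intro x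
  have hx := (contMDiffAt_hom_bundle _).1 (h x)
  refine (contMDiffAt_hom_bundle _).2 ⟨hx.1, ?_⟩
  have h₁ : x ∈ (trivializationAt F₁ E₁ x).baseSet := FiberBundle.mem_baseSet_trivializationAt' x
  have h₂ : x ∈ (trivializationAt F₂ E₂ x).baseSet := FiberBundle.mem_baseSet_trivializationAt' x
  have hinv : (inCoordinates F₁ E₁ F₂ E₂ x x x x (φ x)).IsInvertible := by
    rw [inCoordinates_eq h₁ h₂]
    simpa using hφ x
  -- Inversion of operators is smooth at an invertible one, and near x the inverse read in
  -- trivializations is the inverse of the map read in trivializations.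
  refine ((hinv.contDiffAt_map_inverse (n := n)).contMDiffAt.comp x hx.2).congr_of_eventuallyEq ?_
  filter_upwards [(trivializationAt F₁ E₁ x).open_baseSet.mem_nhds h₁,
    (trivializationAt F₂ E₂ x).open_baseSet.mem_nhds h₂] with y hy₁ hy₂
  dsimp only [Function.comp]
  rw [inCoordinates_eq hy₁ hy₂, inCoordinates_eq hy₂ hy₁]
  simp [comp_assoc]

/-- Every vector in a fibre of a smooth vector bundle is the value of a global smooth section. -/
theorem exists_contMDiff_section {E : Type*} [NormedAddCommGroup E] [NormedSpace ℝ E]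
    [FiniteDimensional ℝ E] {H : Type*} [TopologicalSpace H] {I : ModelWithCorners ℝ E H}
    {M : Type*} [TopologicalSpace M] [ChartedSpace H M] [T2Space M] [IsManifold I ∞ M]
    {F : Type*} [NormedAddCommGroup F] [NormedSpace ℝ F] {V : M → Type*}
    [TopologicalSpace (TotalSpace F V)] [∀ x, AddCommGroup (V x)] [∀ x, Module ℝ (V x)]
    [∀ x, TopologicalSpace (V x)] [FiberBundle F V] [VectorBundle ℝ F V]
    [ContMDiffVectorBundle ∞ F V I] {x : M} (v : V x) :
    ∃ σ : Π y, V y, ContMDiff I (I.prod 𝓘(ℝ, F)) ∞ (fun y ↦ TotalSpace.mk' F y (σ y)) ∧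
      σ x = v := by
  -- The local extension is smooth only on s; a bump function equal to 1 at x and supported inside s
  -- makes it global.
  obtain ⟨s, hs, hσ⟩ := FiberBundle.exists_contMDiffOn_extend I F v (k := ∞)
  obtain ⟨ψ, -, hψ⟩ := (SmoothBumpFunction.nhds_basis_tsupport (I := I) x).mem_iff.1
    (interior_mem_nhds.2 hs)
  refine ⟨fun y ↦ ψ y • FiberBundle.extend F v y, ?_, by simp⟩
  exact ContMDiffOn.smul_section_of_tsupport ψ.contMDiff.contMDiffOn isOpen_interior
    hψ (hσ.mono interior_subset)

variable {E : Type*} [NormedAddCommGroup E] [NormedSpace ℝ E]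
  {H : Type*} [TopologicalSpace H] {I : ModelWithCorners ℝ E H}
  {M : Type*} [TopologicalSpace M] [ChartedSpace H M]

/-! ### Pointwise algebra of the blocks. -/

section Pointwise

variable {P : Π x : M, GT I x →L[ℝ] GT I x}

theorem apply_eq_blocks (x : M) (v : GT I x) :
    P x v = (blockH P x v.1 + blockAlpha P x v.2, blockBeta P x v.1 + blockK P x v.2) := by
  have h : v = (v.1, 0) + (0, v.2) := by simp
  conv_lhs => rw [h, (P x).map_add]
  rfl

theorem alphaInv_blockAlpha (hα : ∀ x, (blockAlpha P x).IsInvertible) (x : M)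
    (ξ : Cotangent I x) : alphaInv P x (blockAlpha P x ξ) = ξ :=
  (hα x).inverse_apply_self ξ

theorem blockAlpha_alphaInv (hα : ∀ x, (blockAlpha P x).IsInvertible) (x : M)
    (X : TangentSpace I x) : blockAlpha P x (alphaInv P x X) = X :=
  (hα x).self_apply_inverse X

theorem blockAlpha_injective (hα : ∀ x, (blockAlpha P x).IsInvertible) (x : M) :
    Function.Injective (blockAlpha P x) :=
  Function.LeftInverse.injective (alphaInv_blockAlpha hα x)

variable [IsManifold I ∞ M]

namespace IsGenAlmostParaComplex

/-- An orthogonal involution is self-adjoint. This yields K = H* and the symmetry of α. -/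
theorem pairing_left (hP : IsGenAlmostParaComplex P) (x : M) (v w : GT I x) :
    pairing (P x v) w = pairing v (P x w) := by
  rw [← hP.orthogonal x v, hP.sq_eq_id]

set_option synthInstance.maxHeartbeats 200000 in
theorem blockH_sq (hP : IsGenAlmostParaComplex P) (x : M) (X : TangentSpace I x) :
    blockH P x (blockH P x X) + blockAlpha P x (blockBeta P x X) = X := by
  have h := hP.sq_eq_id x (X, 0)
  rw [apply_eq_blocks, apply_eq_blocks] at h
  simpa using congrArg Prod.fst h

set_option synthInstance.maxHeartbeats 200000 in
theorem blockH_blockAlpha (hP : IsGenAlmostParaComplex P) (x : M) (ξ : Cotangent I x) :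
    blockH P x (blockAlpha P x ξ) + blockAlpha P x (blockK P x ξ) = 0 := by
  have h := hP.sq_eq_id x (0, ξ)
  rw [apply_eq_blocks, apply_eq_blocks] at h
  simpa using congrArg Prod.fst h

set_option synthInstance.maxHeartbeats 200000 in
theorem blockK_apply (hP : IsGenAlmostParaComplex P) (x : M) (ξ : Cotangent I x)
    (X : TangentSpace I x) : blockK P x ξ X = ξ (blockH P x X) := by
  have h := hP.pairing_left x (0, ξ) (X, 0)
  rw [apply_eq_blocks, apply_eq_blocks] at h
  simpa [pairing] using h

/-- P² = 1 gives Hα = -αK, hence α⁻¹Hα = -K = -H*. -/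
theorem alphaInvH_blockAlpha (hP : IsGenAlmostParaComplex P)
    (hα : ∀ x, (blockAlpha P x).IsInvertible) (x : M) (ξ : Cotangent I x)
    (Y : TangentSpace I x) : alphaInvH P x (blockAlpha P x ξ) Y = -ξ (blockH P x Y) := by
  rw [alphaInvH, ContinuousLinearMap.comp_apply,
    eq_neg_of_add_eq_zero_left (hP.blockH_blockAlpha x ξ), map_neg, alphaInv_blockAlpha hα]
  exact congrArg Neg.neg (hP.blockK_apply x ξ Y)

/-- `α` is symmetric. -/
theorem blockAlpha_symm (hP : IsGenAlmostParaComplex P) (x : M) (ξ η : Cotangent I x) :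
    η (blockAlpha P x ξ) = ξ (blockAlpha P x η) := by
  have h := hP.pairing_left x (0, ξ) (0, η)
  rw [apply_eq_blocks, apply_eq_blocks] at h
  simpa [pairing] using h

/-- `α⁻¹ H` is skew-symmetric. -/
theorem alphaInvH_skew (hP : IsGenAlmostParaComplex P)
    (hα : ∀ x, (blockAlpha P x).IsInvertible) (x : M) (X Y : TangentSpace I x) :
    alphaInvH P x X Y = -alphaInvH P x Y X := by
  -- With X = αξ and Y = αη, the claim follows from α⁻¹Hα = -H*, Hα = -αK, the symmetry of α and K =
  -- H*.
  obtain ⟨ξ, rfl⟩ : ∃ ξ, blockAlpha P x ξ = X := ⟨_, blockAlpha_alphaInv hα x X⟩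
  obtain ⟨η, rfl⟩ : ∃ η, blockAlpha P x η = Y := ⟨_, blockAlpha_alphaInv hα x Y⟩
  rw [hP.alphaInvH_blockAlpha hα, hP.alphaInvH_blockAlpha hα,
    eq_neg_of_add_eq_zero_left (hP.blockH_blockAlpha x η), map_neg,
    hP.blockAlpha_symm, hP.blockK_apply]

end IsGenAlmostParaComplex

end Pointwise

/-! ### Smoothness of the blocks and lifts. -/

section Smooth

variable [IsManifold I ∞ M]

theorem IsSmoothVF.mdifferentiableAt {X : Π x : M, TangentSpace I x} (hX : IsSmoothVF I X)
    (x : M) : MDifferentiableAt I (I.prod 𝓘(ℝ, E)) (fun y ↦ TotalSpace.mk' E y (X y)) x :=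
  ContMDiff.mdifferentiable hX (by simp) x

theorem IsSmoothForm.mdifferentiableAt {η : Π x : M, Cotangent I x} (hη : IsSmoothForm I η)
    (x : M) : MDifferentiableAt I (I.prod 𝓘(ℝ, E →L[ℝ] ℝ))
      (fun y ↦ TotalSpace.mk' (E →L[ℝ] ℝ) (E := fun x : M ↦ Cotangent I x) y (η y)) x :=
  ContMDiff.mdifferentiable hη (by simp) x

theorem IsSmoothForm.contr_mdifferentiableAt {η : Π x : M, Cotangent I x}
    {X : Π x : M, TangentSpace I x} (hη : IsSmoothForm I η) (hX : IsSmoothVF I X) (x : M) :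
    MDifferentiableAt I 𝓘(ℝ, ℝ) (contr η X) x :=
  GenGeom.contr_mdifferentiableAt (hη.mdifferentiableAt x) (hX.mdifferentiableAt x)

theorem IsSmoothSection.add {v w : Π x : M, GT I x} (hv : IsSmoothSection I v)
    (hw : IsSmoothSection I w) : IsSmoothSection I (v + w) :=
  ⟨ContMDiff.add_section hv.1 hw.1, ContMDiff.add_section hv.2 hw.2⟩

variable {P : Π x : M, GT I x →L[ℝ] GT I x}

namespace IsSmoothEnd

theorem blockH_apply (hP : IsSmoothEnd P) {X : Π x : M, TangentSpace I x}
    (hX : IsSmoothVF I X) : IsSmoothVF I (fun x ↦ blockH P x (X x)) :=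
  ContMDiff.clm_bundle_apply hP.smooth_H hX

theorem blockAlpha_apply (hP : IsSmoothEnd P) {ξ : Π x : M, Cotangent I x}
    (hξ : IsSmoothForm I ξ) : IsSmoothVF I (fun x ↦ blockAlpha P x (ξ x)) :=
  ContMDiff.clm_bundle_apply hP.smooth_alpha hξ

theorem blockBeta_apply (hP : IsSmoothEnd P) {X : Π x : M, TangentSpace I x}
    (hX : IsSmoothVF I X) : IsSmoothForm I (fun x ↦ blockBeta P x (X x)) :=
  ContMDiff.clm_bundle_apply hP.smooth_beta hX

theorem blockK_apply (hP : IsSmoothEnd P) {ξ : Π x : M, Cotangent I x}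
    (hξ : IsSmoothForm I ξ) : IsSmoothForm I (fun x ↦ blockK P x (ξ x)) :=
  ContMDiff.clm_bundle_apply hP.smooth_K hξ

theorem apply (hP : IsSmoothEnd P) {v : Π x : M, GT I x} (hv : IsSmoothSection I v) :
    IsSmoothSection I (fun x ↦ P x (v x)) := by
  simp only [apply_eq_blocks]
  exact ⟨ContMDiff.add_section (hP.blockH_apply hv.1) (hP.blockAlpha_apply hv.2),
    ContMDiff.add_section (hP.blockBeta_apply hv.1) (hP.blockK_apply hv.2)⟩

variable [FiniteDimensional ℝ E]

theorem alphaInv_apply (hP : IsSmoothEnd P) (hα : ∀ x, (blockAlpha P x).IsInvertible)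
    {X : Π x : M, TangentSpace I x} (hX : IsSmoothVF I X) :
    IsSmoothForm I (fun x ↦ alphaInv P x (X x)) :=
  have : CompleteSpace E := FiniteDimensional.complete ℝ E
  ContMDiff.clm_bundle_apply (contMDiff_inverse_hom hα hP.smooth_alpha) hX

theorem alphaInvH_apply (hP : IsSmoothEnd P) (hα : ∀ x, (blockAlpha P x).IsInvertible)
    {X : Π x : M, TangentSpace I x} (hX : IsSmoothVF I X) :
    IsSmoothForm I (fun x ↦ alphaInvH P x (X x)) :=
  hP.alphaInv_apply hα (hP.blockH_apply hX)

theorem liftPlus (hP : IsSmoothEnd P) (hα : ∀ x, (blockAlpha P x).IsInvertible)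
    {X : Π x : M, TangentSpace I x} (hX : IsSmoothVF I X) :
    IsSmoothSection I (liftPlus P X) :=
  ⟨hX, ContMDiff.sub_section (hP.alphaInv_apply hα hX) (hP.alphaInvH_apply hα hX)⟩

theorem liftMinus (hP : IsSmoothEnd P) (hα : ∀ x, (blockAlpha P x).IsInvertible)
    {X : Π x : M, TangentSpace I x} (hX : IsSmoothVF I X) :
    IsSmoothSection I (liftMinus P X) :=
  ⟨hX, ContMDiff.sub_section (ContMDiff.neg_section (hP.alphaInv_apply hα hX))
    (hP.alphaInvH_apply hα hX)⟩

end IsSmoothEnd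

end Smooth

/-! ### Rules for directional derivatives. -/

section DirDeriv

variable {f g : M → ℝ} {x : M}

theorem dirDeriv_add (Z : Π x : M, TangentSpace I x) (hf : MDifferentiableAt I 𝓘(ℝ, ℝ) f x)
    (hg : MDifferentiableAt I 𝓘(ℝ, ℝ) g x) :
    dirDeriv Z (f + g) x = dirDeriv Z f x + dirDeriv Z g x := by
  rw [dirDeriv, mvfderiv_add hf hg]
  rfl

theorem dirDeriv_sub (Z : Π x : M, TangentSpace I x) (hf : MDifferentiableAt I 𝓘(ℝ, ℝ) f x)
    (hg : MDifferentiableAt I 𝓘(ℝ, ℝ) g x) :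
    dirDeriv Z (f - g) x = dirDeriv Z f x - dirDeriv Z g x := by
  rw [dirDeriv, mvfderiv_sub hf hg]
  rfl

theorem dirDeriv_neg (Z : Π x : M, TangentSpace I x) :
    dirDeriv Z (-f) x = -dirDeriv Z f x := by
  rw [dirDeriv, mvfderiv_neg]
  rfl

theorem dirDeriv_add_left (Z Z' : Π x : M, TangentSpace I x) :
    dirDeriv (Z + Z') f x = dirDeriv Z f x + dirDeriv Z' f x :=
  map_add (mvfderiv I f x) (Z x) (Z' x)

end DirDeriv

/-! ### The Courant bracket on smooth sections. -/

section Courant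

variable [FiniteDimensional ℝ E] [IsManifold I ∞ M]

/-- Smoothness makes the Lie derivatives tensorial, so `formOf` takes its genuine value rather than
the default 0. -/
theorem courant_snd_apply {v w : Π x : M, GT I x} (hv : IsSmoothSection I v)
    (hw : IsSmoothSection I w) {Z : Π x : M, TangentSpace I x} (hZ : IsSmoothVF I Z) (x : M) :
    (courant v w x).2 (Z x) =
      dirDeriv (fun y ↦ (v y).1) (contr (fun y ↦ (w y).2) Z) x
        - (w x).2 (VectorField.mlieBracket I (fun y ↦ (v y).1) Z x)
        - (dirDeriv (fun y ↦ (w y).1) (contr (fun y ↦ (v y).2) Z) x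
          - (v x).2 (VectorField.mlieBracket I (fun y ↦ (w y).1) Z x))
        - 1 / 2 * (dirDeriv Z (contr (fun y ↦ (w y).2) (fun y ↦ (v y).1)) x
          - dirDeriv Z (contr (fun y ↦ (v y).2) (fun y ↦ (w y).1)) x) := by
  rw [← lieDerivForm_apply (hw.2.mdifferentiableAt x) (hZ.mdifferentiableAt x),
    ← lieDerivForm_apply (hv.2.mdifferentiableAt x) (hZ.mdifferentiableAt x),
    ← dirDeriv_sub Z (hw.2.contr_mdifferentiableAt hv.1 x) (hv.2.contr_mdifferentiableAt hw.1 x)]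
  rfl

/-- Covectors are compared on values of global smooth fields, where each term of the explicit
formula is additive. -/
theorem courant_add_right [T2Space M] {u v w : Π x : M, GT I x} (hu : IsSmoothSection I u)
    (hv : IsSmoothSection I v) (hw : IsSmoothSection I w) (x : M) :
    courant u (v + w) x = courant u v x + courant u w x := by
  have : CompleteSpace E := FiniteDimensional.complete ℝ E
  refine Prod.ext (VectorField.mlieBracket_add_right (hv.1.mdifferentiableAt x)
    (hw.1.mdifferentiableAt x)) (ContinuousLinearMap.ext fun z ↦ ?_)
  obtain ⟨Z, hZ, rfl⟩ := exists_contMDiff_section (I := I) (F := E) z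
  have e₁ (A : Π x : M, TangentSpace I x) : contr (fun y ↦ ((v + w) y).2) A =
      contr (fun y ↦ (v y).2) A + contr (fun y ↦ (w y).2) A := rfl
  have e₂ : (fun y ↦ ((v + w) y).1) = (fun y ↦ (v y).1) + fun y ↦ (w y).1 := rfl
  have e₃ : contr (fun y ↦ (u y).2) ((fun y ↦ (v y).1) + fun y ↦ (w y).1) =
      contr (fun y ↦ (u y).2) (fun y ↦ (v y).1) + contr (fun y ↦ (u y).2) (fun y ↦ (w y).1) := by
    funext y; simp [contr]
  rw [courant_snd_apply hu (hv.add hw) hZ, Prod.snd_add, add_apply, courant_snd_apply hu hv hZ,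
    courant_snd_apply hu hw hZ, e₁, e₁, e₂, e₃,
    dirDeriv_add _ (hv.2.contr_mdifferentiableAt hZ x) (hw.2.contr_mdifferentiableAt hZ x),
    dirDeriv_add _ (hv.2.contr_mdifferentiableAt hu.1 x) (hw.2.contr_mdifferentiableAt hu.1 x),
    dirDeriv_add _ (hu.2.contr_mdifferentiableAt hv.1 x) (hu.2.contr_mdifferentiableAt hw.1 x),
    dirDeriv_add_left,
    VectorField.mlieBracket_add_left (hv.1.mdifferentiableAt x) (hw.1.mdifferentiableAt x),
    map_add, Pi.add_apply, Prod.snd_add, add_apply]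
  ring

end Courant

/-! ### Torsion, parallelism and integrability. -/

section Connection

variable [FiniteDimensional ℝ E] [IsManifold I ∞ M]
  {P : Π x : M, GT I x →L[ℝ] GT I x}

theorem nablaPlus_eq (X Y : Π x : M, TangentSpace I x) (x : M) :
    nablaPlus P X Y x = (1 / 2 : ℝ) • (VectorField.mlieBracket I X Y x
      + (blockH P x (VectorField.mlieBracket I X Y x)
        + blockAlpha P x (courant (liftMinus P X) (liftPlus P Y) x).2)) := by
  rw [nablaPlus, projPlus, apply_eq_blocks]
  rfl

/-- The lift Y ↦ Y⁺ is linear. Additivity is the only connection axiom used below; the Leibniz rule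
is not needed. -/
theorem nablaPlus_add [T2Space M] (hP : IsSmoothEnd P) (hα : ∀ x, (blockAlpha P x).IsInvertible)
    {X Y Y' : Π x : M, TangentSpace I x} (hX : IsSmoothVF I X) (hY : IsSmoothVF I Y)
    (hY' : IsSmoothVF I Y') (x : M) :
    nablaPlus P X (Y + Y') x = nablaPlus P X Y x + nablaPlus P X Y' x := by
  have e : liftPlus P (Y + Y') = liftPlus P Y + liftPlus P Y' := by
    funext y
    refine Prod.ext rfl ?_
    simp only [liftPlus, Pi.add_apply, map_add, Prod.snd_add]
    abel
  simp only [nablaPlus, projPlus]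
  rw [e, courant_add_right (hP.liftMinus hα hX) (hP.liftPlus hα hY) (hP.liftPlus hα hY'),
    (P x).map_add, add_add_add_comm, smul_add, Prod.fst_add]

/-- If `α⁻¹ H` is closed, then the connection `∇⁺` is torsion-free. -/
theorem nablaPlus_torsion_eq_zero [T2Space M] (hP : IsGenAlmostParaComplex P)
    (hα : ∀ x, (blockAlpha P x).IsInvertible) (hclosed : IsClosedTwo (alphaInvH P))
    {X Y : Π x : M, TangentSpace I x} (hX : IsSmoothVF I X) (hY : IsSmoothVF I Y) (x : M) :
    nablaPlus P X Y x - nablaPlus P Y X x = VectorField.mlieBracket I X Y x := by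
  have key : (courant (liftMinus P X) (liftPlus P Y) x).2
      - (courant (liftMinus P Y) (liftPlus P X) x).2
      = -((2 : ℝ) • alphaInvH P x (VectorField.mlieBracket I X Y x)) := by
    refine ContinuousLinearMap.ext fun z ↦ ?_
    obtain ⟨Z, hZ, rfl⟩ := exists_contMDiff_section (I := I) (F := E) z
    have hg {A B : Π x : M, TangentSpace I x} (hA : IsSmoothVF I A) (hB : IsSmoothVF I B) :=
      (hP.smooth.alphaInv_apply hα hA).contr_mdifferentiableAt hB x
    have hb {A B : Π x : M, TangentSpace I x} (hA : IsSmoothVF I A) (hB : IsSmoothVF I B) :=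
      (hP.smooth.alphaInvH_apply hα hA).contr_mdifferentiableAt hB x
    have hplus {A B C : Π x : M, TangentSpace I x} (hA : IsSmoothVF I A) (hB : IsSmoothVF I B) :
        dirDeriv C (contr (fun y ↦ (liftPlus P A y).2) B) x
          = dirDeriv C (contr (fun y ↦ alphaInv P y (A y)) B) x
            - dirDeriv C (contr (fun y ↦ alphaInvH P y (A y)) B) x := by
      rw [← dirDeriv_sub C (hg hA hB) (hb hA hB)]
      rfl
    have hminus {A B C : Π x : M, TangentSpace I x} (hA : IsSmoothVF I A)
        (hB : IsSmoothVF I B) :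
        dirDeriv C (contr (fun y ↦ (liftMinus P A y).2) B) x
          = -dirDeriv C (contr (fun y ↦ alphaInv P y (A y)) B) x
            - dirDeriv C (contr (fun y ↦ alphaInvH P y (A y)) B) x := by
      rw [← dirDeriv_neg, ← dirDeriv_sub C (hg hA hB).neg (hb hA hB)]
      rfl
    have hskew : contr (fun y ↦ alphaInvH P y (Y y)) X
        = -contr (fun y ↦ alphaInvH P y (X y)) Y :=
      funext fun y ↦ hP.alphaInvH_skew hα y _ _
    have hd : dirDeriv X (contr (fun y ↦ alphaInvH P y (Y y)) Z) x
        - dirDeriv Y (contr (fun y ↦ alphaInvH P y (X y)) Z) x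
        + dirDeriv Z (contr (fun y ↦ alphaInvH P y (X y)) Y) x
        - alphaInvH P x (VectorField.mlieBracket I X Y x) (Z x)
        + alphaInvH P x (VectorField.mlieBracket I X Z x) (Y x)
        - alphaInvH P x (VectorField.mlieBracket I Y Z x) (X x) = 0 :=
      hclosed X Y Z hX hY hZ x
    -- The Courant formula has X and Y, not the brackets with Z, in the first slot of b = α⁻¹H.
    rw [hP.alphaInvH_skew hα x (VectorField.mlieBracket I X Z x),
      hP.alphaInvH_skew hα x (VectorField.mlieBracket I Y Z x)] at hd
    have fst_liftPlus (A : Π x : M, TangentSpace I x) : (fun y ↦ (liftPlus P A y).1) = A := rfl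
    have fst_liftMinus (A : Π x : M, TangentSpace I x) : (fun y ↦ (liftMinus P A y).1) = A := rfl
    rw [sub_apply, courant_snd_apply (hP.smooth.liftMinus hα hX) (hP.smooth.liftPlus hα hY) hZ,
      courant_snd_apply (hP.smooth.liftMinus hα hY) (hP.smooth.liftPlus hα hX) hZ]
    simp only [fst_liftPlus, fst_liftMinus]
    rw [hplus hY hZ, hplus hX hZ, hminus hX hZ, hminus hY hZ, hplus hY hX, hplus hX hY,
      hminus hX hY, hminus hY hX, hskew, dirDeriv_neg]
    simp only [liftPlus, liftMinus, sub_apply, neg_apply, smul_apply, smul_eq_mul]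
    -- The b terms of one bracket are antisymmetric in X and Y, so the difference doubles them:
    -- hence -2 db.
    linear_combination (-2) * hd
  have hbr : VectorField.mlieBracket I Y X x = -VectorField.mlieBracket I X Y x :=
    VectorField.mlieBracket_swap_apply
  have hμ := congrArg (blockAlpha P x) key
  rw [map_sub, map_neg, map_smul, alphaInvH, ContinuousLinearMap.comp_apply,
    blockAlpha_alphaInv hα, sub_eq_iff_eq_add] at hμ
  rw [nablaPlus_eq, nablaPlus_eq, hbr, hμ, map_neg]
  module

/-- The connection induced by `∇` on `TM ⊕ T*M`. -/
def genConn (nabla : (Π x : M, TangentSpace I x) → (Π x : M, TangentSpace I x) →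
      (Π x : M, TangentSpace I x)) (X : Π x : M, TangentSpace I x) (v : Π x : M, GT I x) (x : M) :
    GT I x :=
  (nabla X (fun y ↦ (v y).1) x, dualConn nabla X (fun y ↦ (v y).2) x)

/-- Torsion-freeness replaces [X,Y] by ∇_X Y - ∇_Y X; the form parts agree by definition. -/
theorem connBracket_nablaPlus [T2Space M] (hP : IsGenAlmostParaComplex P)
    (hα : ∀ x, (blockAlpha P x).IsInvertible) (hclosed : IsClosedTwo (alphaInvH P))
    {v w : Π x : M, GT I x} (hv : IsSmoothSection I v) (hw : IsSmoothSection I w) (x : M) :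
    connBracket (nablaPlus P) v w x =
      genConn (nablaPlus P) (fun y ↦ (v y).1) w x - genConn (nablaPlus P) (fun y ↦ (w y).1) v x :=
  Prod.ext (nablaPlus_torsion_eq_zero hP hα hclosed hv.1 hw.1 x).symm rfl

/-- If `α` and `H` are parallel for `∇⁺`, then so is `P`. -/
theorem genConn_nablaPlus_apply [T2Space M] (hP : IsGenAlmostParaComplex P)
    (hα : ∀ x, (blockAlpha P x).IsInvertible)
    (hparα : IsParallelCT (nablaPlus P) (blockAlpha P))
    (hparH : IsParallelTT (nablaPlus P) (blockH P))
    {X : Π x : M, TangentSpace I x} {v : Π x : M, GT I x} (hX : IsSmoothVF I X)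
    (hv : IsSmoothSection I v) (x : M) :
    genConn (nablaPlus P) X (fun y ↦ P y (v y)) x = P x (genConn (nablaPlus P) X v x) := by
  have hadd {Y Y' : Π x : M, TangentSpace I x} (hY : IsSmoothVF I Y) (hY' : IsSmoothVF I Y') :=
    nablaPlus_add hP.smooth hα hX hY hY' x
  have hA {η : Π x : M, Cotangent I x} (hη : IsSmoothForm I η) :=
    sub_eq_zero.1 (hparα X η hX hη x)
  have hH {Y : Π x : M, TangentSpace I x} (hY : IsSmoothVF I Y) :=
    sub_eq_zero.1 (hparH X Y hX hY x)
  have hK := hP.smooth.blockK_apply hv.2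
  have hβ := hP.smooth.blockBeta_apply hv.1
  have hAv := hP.smooth.blockAlpha_apply hv.2
  have hHv := hP.smooth.blockH_apply hv.1
  have hzero : nablaPlus P X 0 x = 0 := by
    have h0 : IsSmoothVF I (0 : Π x : M, TangentSpace I x) := contMDiff_zeroSection ℝ _
    simpa using hadd h0 h0
  simp only [apply_eq_blocks, genConn]
  refine Prod.ext ((hadd hHv hAv).trans (congrArg₂ _ (hH hv.1) (hA hv.2)))
    (blockAlpha_injective hα x ?_)
  -- The derivative of the one-form βX + Kξ is known only through α: parallelism of α turns it into
  -- a derivative of the vector field αβX + αKξ, where additivity applies. So `dualConn` is never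
  -- unfolded.
  have h₁ := hA (ContMDiff.add_section hβ hK)
  have h₂ : (fun y ↦ blockAlpha P y (((fun y ↦ blockBeta P y (v y).1)
      + fun y ↦ blockK P y (v y).2) y)) = (fun y ↦ blockAlpha P y (blockBeta P y (v y).1))
      + fun y ↦ blockAlpha P y (blockK P y (v y).2) :=
    funext fun y ↦ map_add _ _ _
  have hαβ := hP.smooth.blockAlpha_apply hβ
  have hαK := hP.smooth.blockAlpha_apply hK
  rw [h₂, hadd hαβ hαK] at h₁
  refine h₁.symm.trans ?_
  have h₃ := hadd (hP.smooth.blockH_apply hHv) hαβ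
  have h₄ := hadd (hP.smooth.blockH_apply hAv) hαK
  have e₃ : (fun y ↦ blockH P y (blockH P y (v y).1))
      + (fun y ↦ blockAlpha P y (blockBeta P y (v y).1)) = fun y ↦ (v y).1 :=
    funext fun y ↦ hP.blockH_sq y _
  have e₄ : (fun y ↦ blockH P y (blockAlpha P y (v y).2))
      + (fun y ↦ blockAlpha P y (blockK P y (v y).2)) = 0 :=
    funext fun y ↦ hP.blockH_blockAlpha y _
  rw [e₃, hH hHv, hH hv.1] at h₃
  rw [e₄, hzero, hH hAv, hA hv.2] at h₄
  -- Adding H²∇X and then Hα∇ξ to both sides completes them to the identities H² + αβ = 1 and Hα +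
  -- αK = 0.
  rw [map_add, ← add_right_inj (blockH P x (blockH P x (nablaPlus P X (fun y ↦ (v y).1) x))),
    ← add_assoc, ← h₃, ← add_assoc, hP.blockH_sq, add_right_inj,
    ← add_right_inj (blockH P x (blockAlpha P x (dualConn (nablaPlus P) X (fun y ↦ (v y).2) x))),
    ← h₄, hP.blockH_blockAlpha]

theorem isIntegrable_connBracket_nablaPlus [T2Space M] (hP : IsGenAlmostParaComplex P)
    (hα : ∀ x, (blockAlpha P x).IsInvertible)
    (hparα : IsParallelCT (nablaPlus P) (blockAlpha P))
    (hparH : IsParallelTT (nablaPlus P) (blockH P)) (hclosed : IsClosedTwo (alphaInvH P)) :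
    IsIntegrable (connBracket (nablaPlus P)) P := by
  intro v w hv hw x
  have hPv := hP.smooth.apply hv
  have hPw := hP.smooth.apply hw
  have hpar {X : Π x : M, TangentSpace I x} {u : Π x : M, GT I x} (hX : IsSmoothVF I X)
      (hu : IsSmoothSection I u) := genConn_nablaPlus_apply hP hα hparα hparH hX hu x
  rw [nijenhuis, connBracket_nablaPlus hP hα hclosed hPv hPw,
    connBracket_nablaPlus hP hα hclosed hPv hw, connBracket_nablaPlus hP hα hclosed hv hPw,
    connBracket_nablaPlus hP hα hclosed hv hw, hpar hPv.1 hw, hpar hPw.1 hv, hpar hw.1 hv,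
    hpar hv.1 hw]
  -- The remaining terms are P∇_{πPv} w, P∇_{πPw} v, ∇_{πv} w and ∇_{πw} v, each occurring twice
  -- with opposite signs.
  simp only [(P x).map_sub, hP.sq_eq_id]
  abel

end Connection

end GenGeom

end

theorem mainTheorem5 {n : ℕ} {M : Type*} [TopologicalSpace M] [T2Space M]
    [SecondCountableTopology M] [ChartedSpace (EuclideanSpace ℝ (Fin n)) M]
    [IsManifold (𝓡 n) ∞ M]
    (P : Π x : M, GenGeom.GT (𝓡 n) x →L[ℝ] GenGeom.GT (𝓡 n) x)
    (hP : GenGeom.IsGenAlmostParaComplex P)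
    (hα : ∀ x, (GenGeom.blockAlpha P x).IsInvertible)
    (hparα : GenGeom.IsParallelCT (GenGeom.nablaPlus P) (GenGeom.blockAlpha P))
    (hparH : GenGeom.IsParallelTT (GenGeom.nablaPlus P) (GenGeom.blockH P))
    (hclosed : GenGeom.IsClosedTwo (GenGeom.alphaInvH P)) :
    GenGeom.IsIntegrable (GenGeom.connBracket (GenGeom.nablaPlus P)) P :=
  GenGeom.isIntegrable_connBracket_nablaPlus hP hα hparα hparH hclosed
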